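/- Let $(\bar M,\bar g)$ be an $(n+2)$-dimensional Lorentzian manifold with Levi-Civita connection $\bar\nabla$, and let $(M,g,S(TM))$ be a null hypersurface: $M$ is an immersed $(n+1)$-manifold whose induced metric $g$ is degenerate, i.e. its radical $\mathrm{rad}(TM)$ admits a nowhere zero global section, and $S(TM)$ is a screen distribution, i.e. a smooth subbundle with $TM=S(TM)\oplus\mathrm{rad}(TM)$. Let $P:TM\to S(TM)$ be the corresponding projection. Let $\mathrm{tr}(TM)$ be the transversal line bundle determined by $S(TM)$, so that $T\bar M|_M=TM\oplus\mathrm{tr}(TM)=S(TM)\oplus\mathrm{rad}(TM)\oplus\mathrm{tr}(TM)$. A normalized pair consists of a section $\xi$ of $\mathrm{rad}(TM)$ and a section $N$ of $\mathrm{tr}(TM)$ with $\bar g(\xi,N)=1$, $\bar g(N,N)=0$ and $\bar g(N,X)=0$ for $X\in S(TM)$. The shape operator $A_N$ and the screen shape operator $A^*_\xi$ are defined by: $-A_NX$ is the $TM$-component of $\bar\nabla_XN$, and $-A^*_\xi X$ is the $S(TM)$-component of $\nabla_X\xi$, where $\nabla_X\xi$ is the $TM$-component of $\bar\nabla_X\xi$.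 The null hypersurface is called screen quasi-conformal if, for a normalized pair $(\xi,N)$, $A_N=\alpha A^*_\xi+\beta P$ with smooth functions $\alpha,\beta$ on $M$. Let $Z$ be a closed conformal vector field on $\bar M$, i.e. $Z$ is smooth and $\bar\nabla_XZ=\varphi X$ for all $X$, with a smooth function $\varphi:\bar M\to\mathbb R$. Suppose that $Z$ is nowhere tangent to $M$ and that the $S(TM)$-component $\overset{*}{Z}$ of $Z$ along $M$ vanishes identically. Then $(M,g,S(TM))$ is screen quasi-conformal. Explicitly, for every normalized pair $(\xi,N)$ the function $\bar g(Z,\xi)$ vanishes nowhere on $M$ and $$A_N=-\frac{\bar g(Z,N)}{\bar g(Z,\xi)}\,A^*_\xi-\frac{\varphi}{\bar g(Z,\xi)}\,P .$$ -/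

import Mathlib

open Bundle Set Topology
open scoped Manifold ContDiff

noncomputable section

/-! ### Linear algebra of a degenerate hyperplane -/

namespace NullLinear

variable {V T : Type*} [AddCommGroup V] [Module ℝ V] [AddCommGroup T] [Module ℝ T]

/-- The radical of the form induced on `T` by `B` through `d : T → V`. -/
def radical (B : V →ₗ[ℝ] V →ₗ[ℝ] ℝ) (d : T →ₗ[ℝ] V) : Submodule ℝ T where
  carrier := {v | ∀ w, B (d v) (d w) = 0}
  add_mem' ha hb w := by simp [ha w, hb w]
  zero_mem' w := by simp
  smul_mem' c v hv w := by simp [hv w]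

/-- The transversal line of a screen `S`: the span of the null vectors `N` that are orthogonal
to `S` and satisfy `B ξ N = 1` for some `ξ` in the radical. -/
def transversal (B : V →ₗ[ℝ] V →ₗ[ℝ] ℝ) (d : T →ₗ[ℝ] V) (S : Submodule ℝ T) : Submodule ℝ V :=
  Submodule.span ℝ {N | ∃ ξ ∈ radical B d, B (d ξ) N = 1 ∧ B N N = 0 ∧ ∀ X ∈ S, B N (d X) = 0}

/-- The ambient space is the direct sum of the hyperplane and the transversal line. -/
theorem isCompl_transversal [FiniteDimensional ℝ V] [FiniteDimensional ℝ T]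
    (B : V →ₗ[ℝ] V →ₗ[ℝ] ℝ) (hsymm : ∀ v w, B v w = B w v)
    (hnd : ∀ v, (∀ w, B v w = 0) → v = 0)
    (d : T →ₗ[ℝ] V) (hd : Function.Injective d)
    (hdim : Module.finrank ℝ V = Module.finrank ℝ T + 1)
    (S : Submodule ℝ T) (hS : IsCompl S (radical B d)) (hR : radical B d ≠ ⊥) :
    IsCompl (LinearMap.range d) (transversal B d S) := by
  obtain ⟨ξ, hξ, hξ0⟩ := (Submodule.ne_bot_iff _).1 hR
  have hξ' : ∀ w, B (d ξ) (d w) = 0 := hξ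
  have hdξ : d ξ ≠ 0 := fun h => hξ0 (hd (by simpa using h))
  -- a vector of `S` orthogonal to `S` vanishes
  have hSnd : ∀ s ∈ S, (∀ X ∈ S, B (d s) (d X) = 0) → s = 0 := by
    intro s hs h
    have hsR : s ∈ radical B d := by
      intro w
      obtain ⟨a, ha, b, hb, rfl⟩ :=
        Submodule.mem_sup.1 (hS.sup_eq_top ▸ Submodule.mem_top : w ∈ S ⊔ radical B d)
      have h2 : B (d s) (d b) = 0 := by rw [hsymm]; exact hb s
      simp [h a ha, h2]
    exact Submodule.disjoint_def.1 hS.disjoint s hs hsR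
  -- the orthogonal projection onto `d S` exists
  have hproj : ∀ u : V, ∃ s ∈ S, ∀ X ∈ S, B (u - d s) (d X) = 0 := by
    intro u
    let F : S →ₗ[ℝ] Module.Dual ℝ S :=
      { toFun := fun s => (B (d s)).comp (d.comp S.subtype)
        map_add' := fun a b => by ext; simp
        map_smul' := fun a b => by ext; simp }
    have hFinj : Function.Injective F := by
      rw [← LinearMap.ker_eq_bot, LinearMap.ker_eq_bot']
      intro s hs
      apply Subtype.ext
      refine hSnd s s.2 fun X hX => ?_
      have := LinearMap.congr_fun hs ⟨X, hX⟩
      simpa [F] using this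
    have hFsurj : Function.Surjective F :=
      (LinearMap.injective_iff_surjective_of_finrank_eq_finrank
        (Subspace.dual_finrank_eq (K := ℝ) (V := S)).symm).1 hFinj
    obtain ⟨s, hs⟩ := hFsurj ((B u).comp (d.comp S.subtype))
    refine ⟨s, s.2, fun X hX => ?_⟩
    have := LinearMap.congr_fun hs ⟨X, hX⟩
    simp only [F, LinearMap.coe_mk, AddHom.coe_mk, LinearMap.comp_apply,
      Submodule.subtype_apply] at this
    simp [this]
  -- existence of `N`
  obtain ⟨N, hN1, hN2, hN3⟩ :
      ∃ N, B (d ξ) N = 1 ∧ B N N = 0 ∧ ∀ X ∈ S, B N (d X) = 0 := by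
    obtain ⟨u, hu⟩ : ∃ u, B (d ξ) u ≠ 0 := by
      by_contra! h
      exact hdξ (hnd _ h)
    obtain ⟨s, hs, hsu⟩ := hproj u
    set v := u - d s with hv
    have hb : B (d ξ) v ≠ 0 := by simpa [hv, hξ' s] using hu
    have hb' : B v (d ξ) = B (d ξ) v := hsymm _ _
    refine ⟨(B (d ξ) v)⁻¹ • (v - (B v v / (2 * B (d ξ) v)) • d ξ), ?_, ?_, ?_⟩
    · simp [hξ' ξ, hb]
    · simp only [map_smul, map_sub, LinearMap.smul_apply, LinearMap.sub_apply, smul_eq_mul, hb',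
        hξ' ξ]
      field_simp
      ring
    · intro X hX
      simp [hsu X hX, hξ' X]
  have hNr : N ∉ LinearMap.range d := by
    rintro ⟨t, rfl⟩
    rw [hξ' t] at hN1
    exact zero_ne_one hN1
  -- the range of `d` and `N` span everything
  have htop : LinearMap.range d ⊔ Submodule.span ℝ {N} = ⊤ := by
    apply Submodule.eq_top_of_finrank_eq
    have h1 : Module.finrank ℝ (LinearMap.range d) = Module.finrank ℝ T :=
      LinearMap.finrank_range_of_inj hd
    have h2 : LinearMap.range d < LinearMap.range d ⊔ Submodule.span ℝ {N} := by
      refine lt_of_le_of_ne le_sup_left fun h => hNr ?_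
      rw [h]
      exact Submodule.mem_sup_right (Submodule.mem_span_singleton_self N)
    have h3 := Submodule.finrank_lt_finrank_of_lt h2
    have h4 := Submodule.finrank_le (LinearMap.range d ⊔ Submodule.span ℝ {N})
    omega
  -- the transversal space is the line through `N`
  have hle : transversal B d S ≤ Submodule.span ℝ {N} := by
    refine Submodule.span_le.2 ?_
    rintro N' ⟨η, hη, h1, h2, h3⟩
    have hη' : ∀ w, B (d η) (d w) = 0 := hη
    have hmem : N' ∈ LinearMap.range d ⊔ Submodule.span ℝ {N} := htop ▸ Submodule.mem_top
    obtain ⟨_, ⟨t, rfl⟩, _, hc, rfl⟩ := Submodule.mem_sup.1 hmem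
    obtain ⟨c, rfl⟩ := Submodule.mem_span_singleton.1 hc
    obtain ⟨s, hs, r, hr, rfl⟩ :=
      Submodule.mem_sup.1 (hS.sup_eq_top ▸ Submodule.mem_top : t ∈ S ⊔ radical B d)
    have hr' : ∀ w, B (d r) (d w) = 0 := hr
    have hs0 : s = 0 := by
      refine hSnd s hs fun X hX => ?_
      simpa [hr' X, hN3 X hX] using h3 X hX
    subst hs0
    have hc0 : c ≠ 0 := by
      rintro rfl
      simp [hη' r] at h1
    have hNr' : B N (d r) = B (d r) N := hsymm _ _
    have hrN : B (d r) N = 0 := by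
      simp [hr' r, hN2, hNr'] at h2
      rcases h2 with h2 | h2
      · exact absurd h2 hc0
      · exact h2
    have hr0 : d r = 0 := by
      refine hnd _ fun w => ?_
      have hw : w ∈ LinearMap.range d ⊔ Submodule.span ℝ {N} := htop ▸ Submodule.mem_top
      obtain ⟨_, ⟨t, rfl⟩, _, hc, rfl⟩ := Submodule.mem_sup.1 hw
      obtain ⟨c, rfl⟩ := Submodule.mem_span_singleton.1 hc
      simp [hr' t, hrN]
    simp [hr0, Submodule.mem_span_singleton]
  have hge : Submodule.span ℝ {N} ≤ transversal B d S := by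
    refine Submodule.span_mono ?_
    rintro _ rfl
    exact ⟨ξ, hξ, hN1, hN2, hN3⟩
  have heq := le_antisymm hle hge
  constructor
  · rw [heq, Submodule.disjoint_def]
    rintro _ ⟨t, rfl⟩ hx
    obtain ⟨c, hc⟩ := Submodule.mem_span_singleton.1 hx
    have h0 : c = 0 := by
      have := hξ' t
      rw [← hc] at this
      simpa [hN1] using this
    rw [← hc, h0, zero_smul]
  · rw [heq, codisjoint_iff, htop]

end NullLinear

/-! ### Lorentzian manifolds and their Levi-Civita connection -/

section Lorentzian

variable (n : ℕ) (Q : Type*) [TopologicalSpace Q] [ChartedSpace (EuclideanSpace ℝ (Fin (n + 2))) Q]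
  [IsManifold (𝓡 (n + 2)) ∞ Q]

/-- A smooth Lorentzian metric, of signature `(-, +, …, +)`, on an `(n+2)`-dimensional manifold. -/
structure LorentzianMetric where
  inner (x : Q) : TangentSpace (𝓡 (n + 2)) x →L[ℝ] TangentSpace (𝓡 (n + 2)) x →L[ℝ] ℝ
  symm (x : Q) (v w : TangentSpace (𝓡 (n + 2)) x) : inner x v w = inner x w v
  lorentzian (x : Q) : ∃ b : Module.Basis (Fin (n + 2)) ℝ (TangentSpace (𝓡 (n + 2)) x),
    ∀ i j, inner x (b i) (b j) = if i = j then (if i = 0 then -1 else 1) else 0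
  contMDiff : ContMDiff (𝓡 (n + 2))
    ((𝓡 (n + 2)).prod 𝓘(ℝ, EuclideanSpace ℝ (Fin (n + 2)) →L[ℝ]
      EuclideanSpace ℝ (Fin (n + 2)) →L[ℝ] ℝ)) ∞
    (fun x ↦ TotalSpace.mk' (EuclideanSpace ℝ (Fin (n + 2)) →L[ℝ]
      EuclideanSpace ℝ (Fin (n + 2)) →L[ℝ] ℝ)
      (E := fun y : Q ↦ TangentSpace (𝓡 (n + 2)) y →L[ℝ] TangentSpace (𝓡 (n + 2)) y →L[ℝ] ℝ)
      x (inner x))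

variable {n Q}

/-- The metric at `x` as a plain bilinear form. -/
def LorentzianMetric.form (g : LorentzianMetric n Q) (x : Q) :
    TangentSpace (𝓡 (n + 2)) x →ₗ[ℝ] TangentSpace (𝓡 (n + 2)) x →ₗ[ℝ] ℝ :=
  (ContinuousLinearMap.coeLM ℝ).comp (g.inner x).toLinearMap

theorem LorentzianMetric.form_apply (g : LorentzianMetric n Q) (x : Q)
    (v w : TangentSpace (𝓡 (n + 2)) x) : g.form x v w = g.inner x v w := rfl

theorem LorentzianMetric.nondegenerate (g : LorentzianMetric n Q) (x : Q)
    (v : TangentSpace (𝓡 (n + 2)) x) (hv : ∀ w, g.inner x v w = 0) : v = 0 := by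
  obtain ⟨b, hb⟩ := g.lorentzian x
  refine b.repr.map_eq_zero_iff.1 (Finsupp.ext fun j => ?_)
  have h := hv (b j)
  rw [← b.sum_repr v] at h
  simp only [map_sum, map_smul, sum_apply, smul_apply, hb,
    smul_eq_mul, mul_ite, mul_one, mul_neg, mul_zero, Finset.sum_ite_eq', Finset.mem_univ,
    if_true] at h
  split_ifs at h <;> simpa using h

/-- A smooth vector field. -/
def IsSmoothField {k : ℕ} {M : Type*} [TopologicalSpace M]
    [ChartedSpace (EuclideanSpace ℝ (Fin k)) M] [IsManifold (𝓡 k) ∞ M]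
    (X : ∀ p : M, TangentSpace (𝓡 k) p) : Prop :=
  ContMDiff (𝓡 k) (𝓡 k).tangent ∞ (fun p ↦ (⟨p, X p⟩ : TangentBundle (𝓡 k) M))

/-- `D` is the Levi-Civita connection of `g`: torsion free and compatible with the metric.
In Mathlib's convention `D Y x v` is `D_v Y`. -/
structure IsLeviCivita (g : LorentzianMetric n Q)
    (D : CovariantDerivative (𝓡 (n + 2)) (EuclideanSpace ℝ (Fin (n + 2)))
      (fun x : Q ↦ TangentSpace (𝓡 (n + 2)) x)) : Prop where
  torsion_free : D.torsion = 0
  metric : ∀ (Y W : ∀ x : Q, TangentSpace (𝓡 (n + 2)) x) (x : Q)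
    (v : TangentSpace (𝓡 (n + 2)) x),
    MDifferentiableAt (𝓡 (n + 2)) (𝓡 (n + 2)).tangent
      (fun y ↦ (⟨y, Y y⟩ : TangentBundle (𝓡 (n + 2)) Q)) x →
    MDifferentiableAt (𝓡 (n + 2)) (𝓡 (n + 2)).tangent
      (fun y ↦ (⟨y, W y⟩ : TangentBundle (𝓡 (n + 2)) Q)) x →
    mvfderiv (𝓡 (n + 2)) (fun y ↦ g.inner y (Y y) (W y)) x v =
      g.inner x (D Y x v) (W x) + g.inner x (Y x) (D W x v)

/-- `Z` is a closed conformal vector field with associated function `φ`: `D_X Z = φ X`. -/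
structure IsClosedConformal
    (D : CovariantDerivative (𝓡 (n + 2)) (EuclideanSpace ℝ (Fin (n + 2)))
      (fun x : Q ↦ TangentSpace (𝓡 (n + 2)) x))
    (Z : ∀ x : Q, TangentSpace (𝓡 (n + 2)) x) (φ : Q → ℝ) : Prop where
  smooth_field : IsSmoothField Z
  smooth_function : ContMDiff (𝓡 (n + 2)) 𝓘(ℝ, ℝ) ∞ φ
  eq : ∀ (x : Q) (X : TangentSpace (𝓡 (n + 2)) x), D Z x X = φ x • X

end Lorentzian

/-! ### The connection along a map -/

section Along

variable {n m : ℕ} {Q : Type*} [TopologicalSpace Q]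
  [ChartedSpace (EuclideanSpace ℝ (Fin n)) Q] [IsManifold (𝓡 n) ∞ Q]
  {M : Type*} [TopologicalSpace M] [ChartedSpace (EuclideanSpace ℝ (Fin m)) M]
  [IsManifold (𝓡 m) ∞ M]

/-- The pullback connection along `f : M → Q`: the derivative `D_v V` of a vector field `V` along
`f` in the direction `v ∈ T_p M`. In the trivialization of `TQ` at `f p`, one differentiates the
components of `V`, and adds the derivative in direction `df v` of the vector field near `f p` whose
components are constant and equal to those of `V p` (the Christoffel symbol term). -/
def covAlong (D : CovariantDerivative (𝓡 n) (EuclideanSpace ℝ (Fin n))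
      (fun x : Q ↦ TangentSpace (𝓡 n) x))
    (f : M → Q) (V : ∀ p : M, TangentSpace (𝓡 n) (f p)) (p : M) :
    TangentSpace (𝓡 m) p →ₗ[ℝ] TangentSpace (𝓡 n) (f p) :=
  (((trivializationAt (EuclideanSpace ℝ (Fin n)) (TangentSpace (𝓡 n)) (f p)).symmL ℝ (f p)).comp
      (mvfderiv (𝓡 m) (fun q : M ↦
        (trivializationAt (EuclideanSpace ℝ (Fin n)) (TangentSpace (𝓡 n)) (f p)
          (⟨f q, V q⟩ : TangentBundle (𝓡 n) Q)).2) p)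
    + (D (FiberBundle.extend (EuclideanSpace ℝ (Fin n)) (V p)) (f p)).comp
      (mfderiv (𝓡 m) (𝓡 n) f p)).toLinearMap

end Along

/-! ### Null hypersurfaces -/

section Null

variable {n : ℕ} {Q : Type*} [TopologicalSpace Q]
  [ChartedSpace (EuclideanSpace ℝ (Fin (n + 2))) Q] [IsManifold (𝓡 (n + 2)) ∞ Q]

/-- A smooth distribution of rank `k`: a field of subspaces of `TM` with local smooth frames. -/
def IsSmoothDistribution {m : ℕ} {M : Type*} [TopologicalSpace M]
    [ChartedSpace (EuclideanSpace ℝ (Fin m)) M] [IsManifold (𝓡 m) ∞ M] (k : ℕ)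
    (S : ∀ p : M, Submodule ℝ (TangentSpace (𝓡 m) p)) : Prop :=
  ∀ p : M, ∃ U ∈ 𝓝 p, ∃ X : Fin k → ∀ q : M, TangentSpace (𝓡 m) q,
    (∀ i, ContMDiffOn (𝓡 m) (𝓡 m).tangent ∞
      (fun q ↦ (⟨q, X i q⟩ : TangentBundle (𝓡 m) M)) U) ∧
    ∀ q ∈ U, LinearIndependent ℝ (fun i ↦ X i q) ∧ Submodule.span ℝ (range fun i ↦ X i q) = S q

/-- The radical space at `p` of the metric induced by `f` from `g`. -/
def LorentzianMetric.rad (g : LorentzianMetric n Q) {M : Type*} [TopologicalSpace M]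
    [ChartedSpace (EuclideanSpace ℝ (Fin (n + 1))) M] (f : M → Q) (p : M) :
    Submodule ℝ (TangentSpace (𝓡 (n + 1)) p) :=
  NullLinear.radical (g.form (f p)) (mfderiv (𝓡 (n + 1)) (𝓡 (n + 2)) f p).toLinearMap

/-- A null hypersurface: an `(n+1)`-manifold `M` immersed in the `(n+2)`-dimensional Lorentzian
manifold `Q` such that there is a nowhere zero vector field on `M` in the radical of the induced
metric, together with a screen distribution, i.e. a smooth distribution complementary to
the radical. -/
structure NullHypersurface (g : LorentzianMetric n Q) (M : Type*) [TopologicalSpace M]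
    [ChartedSpace (EuclideanSpace ℝ (Fin (n + 1))) M] [IsManifold (𝓡 (n + 1)) ∞ M] where
  map : M → Q
  smooth : ContMDiff (𝓡 (n + 1)) (𝓡 (n + 2)) ∞ map
  immersion (p : M) : Function.Injective (mfderiv (𝓡 (n + 1)) (𝓡 (n + 2)) map p)
  degenerate : ∃ ξ : ∀ p : M, TangentSpace (𝓡 (n + 1)) p, IsSmoothField ξ ∧
    ∀ p, ξ p ≠ 0 ∧ ξ p ∈ g.rad map p
  screen (p : M) : Submodule ℝ (TangentSpace (𝓡 (n + 1)) p)
  screen_smooth : IsSmoothDistribution n screen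
  isCompl (p : M) : IsCompl (screen p) (g.rad map p)

namespace NullHypersurface

variable {g : LorentzianMetric n Q} {M : Type*} [TopologicalSpace M]
  [ChartedSpace (EuclideanSpace ℝ (Fin (n + 1))) M] [IsManifold (𝓡 (n + 1)) ∞ M]
  (H : NullHypersurface g M)
  (D : CovariantDerivative (𝓡 (n + 2)) (EuclideanSpace ℝ (Fin (n + 2)))
      (fun x : Q ↦ TangentSpace (𝓡 (n + 2)) x))

/-- The differential of the immersion. -/
def d (p : M) : TangentSpace (𝓡 (n + 1)) p →ₗ[ℝ] TangentSpace (𝓡 (n + 2)) (H.map p) :=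
  (mfderiv (𝓡 (n + 1)) (𝓡 (n + 2)) H.map p).toLinearMap

/-- The fibre at `p` of the transversal bundle `tr(TM)`. -/
def tr (p : M) : Submodule ℝ (TangentSpace (𝓡 (n + 2)) (H.map p)) :=
  NullLinear.transversal (g.form (H.map p)) (H.d p) (H.screen p)

/-- The decomposition `TQ = TM ⊕ tr(TM)` along the hypersurface. -/
theorem isCompl_tr (p : M) : IsCompl (LinearMap.range (H.d p)) (H.tr p) := by
  have : FiniteDimensional ℝ (TangentSpace (𝓡 (n + 1)) p) :=
    inferInstanceAs (FiniteDimensional ℝ (EuclideanSpace ℝ (Fin (n + 1))))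
  have : FiniteDimensional ℝ (TangentSpace (𝓡 (n + 2)) (H.map p)) :=
    inferInstanceAs (FiniteDimensional ℝ (EuclideanSpace ℝ (Fin (n + 2))))
  have h1 : Module.finrank ℝ (TangentSpace (𝓡 (n + 1)) p) = n + 1 :=
    finrank_euclideanSpace_fin (𝕜 := ℝ) (n := n + 1)
  have h2 : Module.finrank ℝ (TangentSpace (𝓡 (n + 2)) (H.map p)) = n + 2 :=
    finrank_euclideanSpace_fin (𝕜 := ℝ) (n := n + 2)
  refine NullLinear.isCompl_transversal (g.form (H.map p)) (g.symm _) (g.nondegenerate _)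
    (H.d p) (H.immersion p) (by omega) (H.screen p) (H.isCompl p) ?_
  obtain ⟨ξ, -, hξ⟩ := H.degenerate
  exact (Submodule.ne_bot_iff _).2 ⟨ξ p, (hξ p).2, (hξ p).1⟩

/-- The projection of the ambient tangent space onto `T_p M` along `tr(TM)`. -/
def tan (p : M) : TangentSpace (𝓡 (n + 2)) (H.map p) →ₗ[ℝ] TangentSpace (𝓡 (n + 1)) p :=
  ((LinearEquiv.ofInjective (H.d p) (H.immersion p)).symm.toLinearMap).comp
    (Submodule.projectionOnto _ _ (H.isCompl_tr p))

/-- The projection `P` of `T_p M` onto the screen along the radical. -/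
def P (p : M) : TangentSpace (𝓡 (n + 1)) p →ₗ[ℝ] TangentSpace (𝓡 (n + 1)) p :=
  Submodule.projection _ _ (H.isCompl p)

/-- The screen component `Z*` in the decomposition `TQ = S(TM) ⊕ rad(TM) ⊕ tr(TM)`. -/
def screenComponent (Z : ∀ x : Q, TangentSpace (𝓡 (n + 2)) x) (p : M) :
    TangentSpace (𝓡 (n + 1)) p :=
  H.P p (H.tan p (Z (H.map p)))

/-- The shape operator `A_V`, where `D_X V = - A_V X + ∇ᵗ_X V` with `A_V X` tangent to `M` and
`∇ᵗ_X V` in `tr(TM)`. -/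
def shape (V : ∀ p : M, TangentSpace (𝓡 (n + 2)) (H.map p)) (p : M) :
    TangentSpace (𝓡 (n + 1)) p →ₗ[ℝ] TangentSpace (𝓡 (n + 1)) p :=
  -(H.tan p).comp (covAlong D H.map V p)

/-- The induced connection `∇_X Y`, the `TM`-part of `D_X Y`, for `Y` tangent to `M`. -/
def induced (Y : ∀ p : M, TangentSpace (𝓡 (n + 1)) p) (p : M) :
    TangentSpace (𝓡 (n + 1)) p →ₗ[ℝ] TangentSpace (𝓡 (n + 1)) p :=
  (H.tan p).comp (covAlong D H.map (fun q ↦ H.d q (Y q)) p)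

/-- The screen shape operator `A*_U`, where `∇_X U = - A*_U X + ∇*ᵗ_X U` with `A*_U X` in the
screen and `∇*ᵗ_X U` in the radical. -/
def screenShape (U : ∀ p : M, TangentSpace (𝓡 (n + 1)) p) (p : M) :
    TangentSpace (𝓡 (n + 1)) p →ₗ[ℝ] TangentSpace (𝓡 (n + 1)) p :=
  -(H.P p).comp (H.induced D U p)

/-- A normalized pair: a section `ξ` of `rad(TM)` and a smooth field `N` along `M` with
`g(ξ, N) = 1`, `g(N, N) = 0` and `g(N, X) = 0` for `X` in the screen. -/
structure IsNullPair (ξ : ∀ p : M, TangentSpace (𝓡 (n + 1)) p)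
    (N : ∀ p : M, TangentSpace (𝓡 (n + 2)) (H.map p)) : Prop where
  smooth_xi : IsSmoothField ξ
  mem_rad (p : M) : ξ p ∈ g.rad H.map p
  smooth_N : ContMDiff (𝓡 (n + 1)) (𝓡 (n + 2)).tangent ∞
    (fun p ↦ (⟨H.map p, N p⟩ : TangentBundle (𝓡 (n + 2)) Q))
  pairing (p : M) : g.inner (H.map p) (H.d p (ξ p)) (N p) = 1
  null (p : M) : g.inner (H.map p) (N p) (N p) = 0
  orthogonal (p : M) : ∀ X ∈ H.screen p, g.inner (H.map p) (N p) (H.d p X) = 0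

/-- `A_N = α A*_ξ + β P` with `α`, `β` smooth functions on `M`. -/
def IsQuasiConformalPair (ξ : ∀ p : M, TangentSpace (𝓡 (n + 1)) p)
    (N : ∀ p : M, TangentSpace (𝓡 (n + 2)) (H.map p)) (α β : M → ℝ) : Prop :=
  ContMDiff (𝓡 (n + 1)) 𝓘(ℝ, ℝ) ∞ α ∧ ContMDiff (𝓡 (n + 1)) 𝓘(ℝ, ℝ) ∞ β ∧
    ∀ p, H.shape D N p = α p • H.screenShape D ξ p + β p • H.P p

/-- The null hypersurface is screen quasi-conformal. Replacing `(ξ, N)` by `(f ξ, N / f)` only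
rescales the coefficients, so the property does not depend on the pair. -/
def IsScreenQuasiConformal : Prop :=
  ∃ ξ N, H.IsNullPair ξ N ∧ ∃ α β : M → ℝ, H.IsQuasiConformalPair D ξ N α β

end NullHypersurface

end Null

end

/-! Put `a = g(Z, N)` and `b = g(Z, ξ)`. Vanishing of the screen component makes `Z` orthogonal to
the screen, so `Z = a ξ + b N` along the hypersurface; since `Z` is never tangent, `b` has no zero.
Differentiating along a tangent vector `X`, closed conformality turns the left side into `φ X`, and
the Leibniz rule gives `φ X = X(a) ξ + a D_X ξ + X(b) N + b D_X N`. The screen part of this identity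
kills the terms in `ξ` and `N` and reads `φ P X = -a A*_ξ X - b P A_N X`. Constancy of `g(N, N)`
puts `A_N X` in the screen, so `P A_N = A_N`, and division by `b` gives the formula.

The analytic input is that the pullback connection `covAlong`, defined through trivializations, is
metric (`IsLeviCivita.mvfderiv_inner_along`); its chain and Leibniz rules then follow by
nondegeneracy. The algebraic input is the decomposition `NullLinear.IsPair.eq_smul_add_smul`. Since
quasi-conformality asserts that some normalized pair exists, `exists_isNullPair` builds a smooth one
by solving `Z = a ξ + b N` for `N`. -/

theorem mvfderiv_clm_apply {m : ℕ} {M : Type*} [TopologicalSpace M]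
    [ChartedSpace (EuclideanSpace ℝ (Fin m)) M] {F₁ F₂ : Type*} [NormedAddCommGroup F₁]
    [NormedSpace ℝ F₁] [NormedAddCommGroup F₂] [NormedSpace ℝ F₂] {Φ : M → F₁ →L[ℝ] F₂}
    {u : M → F₁} {p : M} (hΦ : MDifferentiableAt (𝓡 m) 𝓘(ℝ, F₁ →L[ℝ] F₂) Φ p)
    (hu : MDifferentiableAt (𝓡 m) 𝓘(ℝ, F₁) u p) (v : TangentSpace (𝓡 m) p) :
    mvfderiv (𝓡 m) (fun q ↦ Φ q (u q)) p v =
      Φ p (mvfderiv (𝓡 m) u p v) + mvfderiv (𝓡 m) Φ p v (u p) := by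
  let Φ' : EuclideanSpace ℝ (Fin m) →L[ℝ] F₁ →L[ℝ] F₂ := mvfderiv (𝓡 m) Φ p
  let u' : EuclideanSpace ℝ (Fin m) →L[ℝ] F₁ := mvfderiv (𝓡 m) u p
  have h : HasMFDerivAt (𝓡 m) 𝓘(ℝ, F₂) (fun q ↦ Φ q (u q)) p
      ((Φ p).comp u' + Φ'.flip (u p)) := by
    refine ⟨ContinuousAt.clm_apply hΦ.continuousAt hu.continuousAt, ?_⟩
    convert! hΦ.hasMFDerivAt.2.clm_apply hu.hasMFDerivAt.2
    simp
    rfl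
  rw [mvfderiv, h.mfderiv]
  rfl

theorem mvfderiv_congr {m : ℕ} {M : Type*} [TopologicalSpace M]
    [ChartedSpace (EuclideanSpace ℝ (Fin m)) M] {F : Type*} [NormedAddCommGroup F]
    [NormedSpace ℝ F] {u w : M → F} {p : M} (h : u =ᶠ[𝓝 p] w) :
    mvfderiv (𝓡 m) u p = mvfderiv (𝓡 m) w p := by
  ext v
  simp only [mvfderiv, ContinuousLinearMap.comp_apply, h.mfderiv_eq]
  rfl

/-! ### Calculus of the pullback connection along a map -/

section

variable {n m : ℕ} {Q : Type*} [TopologicalSpace Q]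
  [ChartedSpace (EuclideanSpace ℝ (Fin (n + 2))) Q] [IsManifold (𝓡 (n + 2)) ∞ Q]
  {M : Type*} [TopologicalSpace M] [ChartedSpace (EuclideanSpace ℝ (Fin m)) M]

/-- The metric in the trivialization of the tangent bundle at `x₀`. -/
noncomputable def LorentzianMetric.coord (g : LorentzianMetric n Q) (x₀ x : Q) :
    EuclideanSpace ℝ (Fin (n + 2)) →L[ℝ] EuclideanSpace ℝ (Fin (n + 2)) →L[ℝ] ℝ :=
  ContinuousLinearMap.inCoordinates (EuclideanSpace ℝ (Fin (n + 2))) (TangentSpace (𝓡 (n + 2)))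
    (EuclideanSpace ℝ (Fin (n + 2)) →L[ℝ] ℝ) (fun y : Q ↦ TangentSpace (𝓡 (n + 2)) y →L[ℝ] ℝ)
    x₀ x x₀ x (g.inner x)

theorem LorentzianMetric.coord_apply (g : LorentzianMetric n Q) {x₀ x : Q}
    (hx : x ∈ (trivializationAt (EuclideanSpace ℝ (Fin (n + 2))) (TangentSpace (𝓡 (n + 2)))
      x₀).baseSet) (v w : EuclideanSpace ℝ (Fin (n + 2))) :
    g.coord x₀ x v w = g.inner x
      ((trivializationAt (EuclideanSpace ℝ (Fin (n + 2))) (TangentSpace (𝓡 (n + 2))) x₀).symm x v)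
      ((trivializationAt (EuclideanSpace ℝ (Fin (n + 2))) (TangentSpace (𝓡 (n + 2))) x₀).symm
        x w) := by
  have := inCoordinates_apply_eq₂ (𝕜 := ℝ) (F₁ := EuclideanSpace ℝ (Fin (n + 2)))
    (F₂ := EuclideanSpace ℝ (Fin (n + 2))) (F₃ := ℝ) (E₁ := TangentSpace (𝓡 (n + 2)) (M := Q))
    (E₂ := TangentSpace (𝓡 (n + 2)) (M := Q)) (E₃ := Bundle.Trivial Q ℝ) (ϕ := g.inner x)
    (v := v) (w := w) hx hx (mem_univ _)
  exact this.trans (by simp)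

theorem LorentzianMetric.mdifferentiableAt_coord (g : LorentzianMetric n Q) (x₀ : Q) :
    MDifferentiableAt (𝓡 (n + 2)) 𝓘(ℝ, EuclideanSpace ℝ (Fin (n + 2)) →L[ℝ]
      EuclideanSpace ℝ (Fin (n + 2)) →L[ℝ] ℝ) (g.coord x₀) x₀ :=
  ((mdifferentiableAt_hom_bundle _).1 (g.contMDiff.mdifferentiableAt (by simp))).2

theorem LorentzianMetric.contMDiff_inner (g : LorentzianMetric n Q) {f : M → Q}
    {V W : ∀ p : M, TangentSpace (𝓡 (n + 2)) (f p)}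
    (hV : ContMDiff (𝓡 m) (𝓡 (n + 2)).tangent ∞
      (fun p ↦ (⟨f p, V p⟩ : TangentBundle (𝓡 (n + 2)) Q)))
    (hW : ContMDiff (𝓡 m) (𝓡 (n + 2)).tangent ∞
      (fun p ↦ (⟨f p, W p⟩ : TangentBundle (𝓡 (n + 2)) Q))) :
    ContMDiff (𝓡 m) 𝓘(ℝ, ℝ) ∞ (fun p ↦ g.inner (f p) (V p) (W p)) := by
  intro p
  have hf : ContMDiffAt (𝓡 m) (𝓡 (n + 2)) ∞ f p := (contMDiffAt_totalSpace.1 (hV p)).1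
  have : ContMDiffAt (𝓡 m) ((𝓡 (n + 2)).prod 𝓘(ℝ)) ∞
      (fun q ↦ TotalSpace.mk' ℝ (E := Bundle.Trivial Q ℝ) (f q) (g.inner (f q) (V q) (W q))) p := by
    apply ContMDiffAt.clm_bundle_apply₂ (F₁ := EuclideanSpace ℝ (Fin (n + 2)))
      (F₂ := EuclideanSpace ℝ (Fin (n + 2)))
    · exact g.contMDiff.contMDiffAt.comp p hf
    · exact hV p
    · exact hW p
  exact (contMDiffAt_totalSpace.1 this).2

theorem mdifferentiableAt_extend_tangent {x : Q} (v : TangentSpace (𝓡 (n + 2)) x) :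
    MDifferentiableAt (𝓡 (n + 2)) (𝓡 (n + 2)).tangent
      (fun y ↦ (⟨y, FiberBundle.extend (EuclideanSpace ℝ (Fin (n + 2))) v y⟩ :
        TangentBundle (𝓡 (n + 2)) Q)) x := by
  have := FiberBundle.mdifferentiableAt_extend (𝓡 (n + 2)) (EuclideanSpace ℝ (Fin (n + 2))) v
  exact this

/-- The pullback of the Levi-Civita connection is compatible with the metric. -/
theorem IsLeviCivita.mvfderiv_inner_along [IsManifold (𝓡 m) ∞ M] {g : LorentzianMetric n Q}
    {D : CovariantDerivative (𝓡 (n + 2)) (EuclideanSpace ℝ (Fin (n + 2)))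
      (fun x : Q ↦ TangentSpace (𝓡 (n + 2)) x)} (hD : IsLeviCivita g D) {f : M → Q}
    {V W : ∀ p : M, TangentSpace (𝓡 (n + 2)) (f p)} {p : M}
    (hV : MDifferentiableAt (𝓡 m) (𝓡 (n + 2)).tangent
      (fun p ↦ (⟨f p, V p⟩ : TangentBundle (𝓡 (n + 2)) Q)) p)
    (hW : MDifferentiableAt (𝓡 m) (𝓡 (n + 2)).tangent
      (fun p ↦ (⟨f p, W p⟩ : TangentBundle (𝓡 (n + 2)) Q)) p) (v : TangentSpace (𝓡 m) p) :
    mvfderiv (𝓡 m) (fun q ↦ g.inner (f q) (V q) (W q)) p v =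
      g.inner (f p) (covAlong D f V p v) (W p) + g.inner (f p) (V p) (covAlong D f W p v) := by
  set e := trivializationAt (EuclideanSpace ℝ (Fin (n + 2)))
    (TangentSpace (𝓡 (n + 2)) (M := Q)) (f p) with he
  have hV' := (mdifferentiableAt_totalSpace ..).1 hV
  have hW' := (mdifferentiableAt_totalSpace ..).1 hW
  have hf : MDifferentiableAt (𝓡 m) (𝓡 (n + 2)) f p := hV'.1
  set a : M → EuclideanSpace ℝ (Fin (n + 2)) :=
    fun q ↦ (e (⟨f q, V q⟩ : TangentBundle (𝓡 (n + 2)) Q)).2 with ha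
  set b : M → EuclideanSpace ℝ (Fin (n + 2)) :=
    fun q ↦ (e (⟨f q, W q⟩ : TangentBundle (𝓡 (n + 2)) Q)).2 with hb
  have ha' : MDifferentiableAt (𝓡 m) 𝓘(ℝ, EuclideanSpace ℝ (Fin (n + 2))) a p := hV'.2
  have hb' : MDifferentiableAt (𝓡 m) 𝓘(ℝ, EuclideanSpace ℝ (Fin (n + 2))) b p := hW'.2
  have hmem : f p ∈ e.baseSet := FiberBundle.mem_baseSet_trivializationAt' (f p)
  have hnear : ∀ᶠ x in 𝓝 (f p), x ∈ e.baseSet := e.open_baseSet.mem_nhds hmem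
  have hG := g.mdifferentiableAt_coord (f p)
  have hGf := hG.comp p hf
  -- In the trivialization at `f p` the pairing is the metric matrix along `f` evaluated on the
  -- components `a`, `b`; this holds only over the base set, hence near `p`.
  have h1 : (fun q ↦ g.inner (f q) (V q) (W q)) =ᶠ[𝓝 p]
      fun q ↦ (g.coord (f p) ∘ f) q (a q) (b q) := by
    filter_upwards [hf.continuousAt.eventually hnear] with q hq
    simp only [Function.comp_apply]
    rw [g.coord_apply hq, ← he, ha, hb, e.symm_apply_apply_mk hq, e.symm_apply_apply_mk hq]
  -- The extensions of `V p` and `W p` have constant components, so only the metric matrix varies.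
  have h2 : (fun x ↦ g.inner x (FiberBundle.extend (EuclideanSpace ℝ (Fin (n + 2))) (V p) x)
      (FiberBundle.extend (EuclideanSpace ℝ (Fin (n + 2))) (W p) x)) =ᶠ[𝓝 (f p)]
      fun x ↦ g.coord (f p) x (a p) (b p) := by
    filter_upwards [hnear] with x hx
    rw [g.coord_apply hx]
    rfl
  have hGa : MDifferentiableAt (𝓡 (n + 2)) 𝓘(ℝ, EuclideanSpace ℝ (Fin (n + 2)) →L[ℝ] ℝ)
      (fun x ↦ g.coord (f p) x (a p)) (f p) := hG.clm_apply mdifferentiableAt_const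
  have hGab : MDifferentiableAt (𝓡 (n + 2)) 𝓘(ℝ, ℝ)
      (fun x ↦ g.coord (f p) x (a p) (b p)) (f p) := hGa.clm_apply mdifferentiableAt_const
  have hGfa : MDifferentiableAt (𝓡 m) 𝓘(ℝ, EuclideanSpace ℝ (Fin (n + 2)) →L[ℝ] ℝ)
      (fun q ↦ (g.coord (f p) ∘ f) q (a p)) p := hGf.clm_apply mdifferentiableAt_const
  -- The derivative of the metric matrix on frozen components equals the two Christoffel terms of
  -- `covAlong`: this is compatibility of `D` with the metric for the constant-component extensions.
  -- The remaining two terms of the product rule differentiate `a` and `b`.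
  have h3 : mvfderiv (𝓡 m) (g.coord (f p) ∘ f) p v (a p) (b p) =
      g.inner (f p) (D (FiberBundle.extend (EuclideanSpace ℝ (Fin (n + 2))) (V p)) (f p)
        (mfderiv (𝓡 m) (𝓡 (n + 2)) f p v)) (W p) +
      g.inner (f p) (V p) (D (FiberBundle.extend (EuclideanSpace ℝ (Fin (n + 2))) (W p)) (f p)
        (mfderiv (𝓡 m) (𝓡 (n + 2)) f p v)) := by
    have h4 := hD.metric (FiberBundle.extend (EuclideanSpace ℝ (Fin (n + 2))) (V p))
      (FiberBundle.extend (EuclideanSpace ℝ (Fin (n + 2))) (W p)) (f p)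
      (mfderiv (𝓡 m) (𝓡 (n + 2)) f p v) (mdifferentiableAt_extend_tangent _)
      (mdifferentiableAt_extend_tangent _)
    rw [mvfderiv_congr h2, ← mvfderiv_comp_apply p hGab hf v, FiberBundle.extend_apply_self,
      FiberBundle.extend_apply_self] at h4
    rw [← h4]
    have h5 := mvfderiv_clm_apply hGf (mdifferentiableAt_const (c := a p)) v
    have h6 := mvfderiv_clm_apply hGfa (mdifferentiableAt_const (c := b p)) v
    rw [mvfderiv_const] at h5 h6
    simp only [zero_apply, map_zero, zero_add] at h5 h6
    rw [← h5]
    exact h6.symm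
  rw [mvfderiv_congr h1, mvfderiv_clm_apply (hGf.clm_apply ha') hb' v,
    mvfderiv_clm_apply hGf ha' v, add_apply, h3]
  simp only [Function.comp_apply, g.coord_apply hmem, ← he]
  have hc (X : ∀ p : M, TangentSpace (𝓡 (n + 2)) (f p)) : covAlong D f X p v =
      e.symm (f p) (mvfderiv (𝓡 m) (fun q : M ↦
        (e (⟨f q, X q⟩ : TangentBundle (𝓡 (n + 2)) Q)).2) p v) +
      D (FiberBundle.extend (EuclideanSpace ℝ (Fin (n + 2))) (X p)) (f p)
        (mfderiv (𝓡 m) (𝓡 (n + 2)) f p v) := by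
    rw [← e.symmL_apply (R := ℝ) hmem]
    rfl
  rw [hc V, hc W, ha, hb, e.symm_apply_apply_mk hmem, e.symm_apply_apply_mk hmem]
  simp only [map_add, add_apply]
  ring

theorem LorentzianMetric.ext_inner (g : LorentzianMetric n Q) {x : Q}
    {v w : TangentSpace (𝓡 (n + 2)) x} (h : ∀ u, g.inner x v u = g.inner x w u) : v = w :=
  sub_eq_zero.1 (g.nondegenerate x _ fun u ↦ by simp [h u])

theorem mdifferentiableAt_field_comp {f : M → Q} {p : M}
    {Z : ∀ x : Q, TangentSpace (𝓡 (n + 2)) x}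
    (hZ : MDifferentiableAt (𝓡 (n + 2)) (𝓡 (n + 2)).tangent
      (fun y ↦ (⟨y, Z y⟩ : TangentBundle (𝓡 (n + 2)) Q)) (f p))
    (hf : MDifferentiableAt (𝓡 m) (𝓡 (n + 2)) f p) :
    MDifferentiableAt (𝓡 m) (𝓡 (n + 2)).tangent
      (fun q ↦ (⟨f q, Z (f q)⟩ : TangentBundle (𝓡 (n + 2)) Q)) p :=
  hZ.comp p hf

theorem LorentzianMetric.mdifferentiableAt_inner (g : LorentzianMetric n Q) {f : M → Q} {p : M}
    {V W : ∀ p : M, TangentSpace (𝓡 (n + 2)) (f p)}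
    (hV : MDifferentiableAt (𝓡 m) (𝓡 (n + 2)).tangent
      (fun p ↦ (⟨f p, V p⟩ : TangentBundle (𝓡 (n + 2)) Q)) p)
    (hW : MDifferentiableAt (𝓡 m) (𝓡 (n + 2)).tangent
      (fun p ↦ (⟨f p, W p⟩ : TangentBundle (𝓡 (n + 2)) Q)) p) :
    MDifferentiableAt (𝓡 m) 𝓘(ℝ, ℝ) (fun p ↦ g.inner (f p) (V p) (W p)) p := by
  have hf : MDifferentiableAt (𝓡 m) (𝓡 (n + 2)) f p := ((mdifferentiableAt_totalSpace ..).1 hV).1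
  have : MDifferentiableAt (𝓡 m) ((𝓡 (n + 2)).prod 𝓘(ℝ))
      (fun q ↦ TotalSpace.mk' ℝ (E := Bundle.Trivial Q ℝ) (f q) (g.inner (f q) (V q) (W q))) p := by
    apply MDifferentiableAt.clm_bundle_apply₂ (F₁ := EuclideanSpace ℝ (Fin (n + 2)))
      (F₂ := EuclideanSpace ℝ (Fin (n + 2)))
    · exact (g.contMDiff.mdifferentiableAt (by simp)).comp p hf
    · exact hV
    · exact hW
  exact ((mdifferentiableAt_totalSpace ..).1 this).2

/-- The extension has constant components near `f p`, so the component derivative vanishes and only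
the Christoffel term survives. This supplies the chain rule for the test fields used to prove it in
general. -/
theorem covAlong_field_comp_extend {D : CovariantDerivative (𝓡 (n + 2))
      (EuclideanSpace ℝ (Fin (n + 2))) (fun x : Q ↦ TangentSpace (𝓡 (n + 2)) x)}
    [IsManifold (𝓡 m) ∞ M] {f : M → Q} {p : M} (hf : MDifferentiableAt (𝓡 m) (𝓡 (n + 2)) f p)
    (w : TangentSpace (𝓡 (n + 2)) (f p)) (v : TangentSpace (𝓡 m) p) :
    covAlong D f (fun q ↦ FiberBundle.extend (EuclideanSpace ℝ (Fin (n + 2))) w (f q)) p v =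
      D (FiberBundle.extend (EuclideanSpace ℝ (Fin (n + 2))) w) (f p)
        (mfderiv (𝓡 m) (𝓡 (n + 2)) f p v) := by
  set e := trivializationAt (EuclideanSpace ℝ (Fin (n + 2)))
    (TangentSpace (𝓡 (n + 2)) (M := Q)) (f p) with he
  have hmem : f p ∈ e.baseSet := FiberBundle.mem_baseSet_trivializationAt' (f p)
  have h : (fun q : M ↦ (e (⟨f q, FiberBundle.extend (EuclideanSpace ℝ (Fin (n + 2))) w (f q)⟩ :
      TangentBundle (𝓡 (n + 2)) Q)).2) =ᶠ[𝓝 p]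
      fun _ ↦ (e (⟨f p, w⟩ : TangentBundle (𝓡 (n + 2)) Q)).2 := by
    filter_upwards [hf.continuousAt.eventually (e.open_baseSet.mem_nhds hmem)] with q hq
    have := congrArg Prod.snd
      (e.apply_mk_symm hq (e (⟨f p, w⟩ : TangentBundle (𝓡 (n + 2)) Q)).2)
    exact this
  have hc : covAlong D f
      (fun q ↦ FiberBundle.extend (EuclideanSpace ℝ (Fin (n + 2))) w (f q)) p v =
      e.symmL ℝ (f p) (mvfderiv (𝓡 m) (fun q : M ↦ (e (⟨f q, FiberBundle.extend
        (EuclideanSpace ℝ (Fin (n + 2))) w (f q)⟩ : TangentBundle (𝓡 (n + 2)) Q)).2) p v) +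
      D (FiberBundle.extend (EuclideanSpace ℝ (Fin (n + 2)))
        (FiberBundle.extend (EuclideanSpace ℝ (Fin (n + 2))) w (f p))) (f p)
        (mfderiv (𝓡 m) (𝓡 (n + 2)) f p v) := rfl
  rw [hc, mvfderiv_congr h, mvfderiv_const, FiberBundle.extend_apply_self]
  simp

variable [IsManifold (𝓡 m) ∞ M] {g : LorentzianMetric n Q}
  {D : CovariantDerivative (𝓡 (n + 2)) (EuclideanSpace ℝ (Fin (n + 2)))
    (fun x : Q ↦ TangentSpace (𝓡 (n + 2)) x)}

/-- The pullback of the Levi-Civita connection satisfies the chain rule. -/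
theorem IsLeviCivita.covAlong_field_comp (hD : IsLeviCivita g D) {f : M → Q} {p : M}
    {Z : ∀ x : Q, TangentSpace (𝓡 (n + 2)) x}
    (hZ : MDifferentiableAt (𝓡 (n + 2)) (𝓡 (n + 2)).tangent
      (fun y ↦ (⟨y, Z y⟩ : TangentBundle (𝓡 (n + 2)) Q)) (f p))
    (hf : MDifferentiableAt (𝓡 m) (𝓡 (n + 2)) f p) (v : TangentSpace (𝓡 m) p) :
    covAlong D f (fun q ↦ Z (f q)) p v = D Z (f p) (mfderiv (𝓡 m) (𝓡 (n + 2)) f p v) := by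
  -- By nondegeneracy it suffices to pair with each `u`. Extending `u` to a test field, the product
  -- rules along `f` and on the ambient manifold compute the same derivative, and their terms
  -- differentiating the test field cancel.
  refine g.ext_inner fun u ↦ ?_
  have hu := mdifferentiableAt_extend_tangent u
  have h1 := hD.mvfderiv_inner_along (mdifferentiableAt_field_comp hZ hf)
    (mdifferentiableAt_field_comp hu hf) v
  have h2 := hD.metric Z (FiberBundle.extend (EuclideanSpace ℝ (Fin (n + 2))) u) (f p)
    (mfderiv (𝓡 m) (𝓡 (n + 2)) f p v) hZ hu
  have hZu : MDifferentiableAt (𝓡 (n + 2)) 𝓘(ℝ, ℝ) (fun y ↦ g.inner y (Z y)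
      (FiberBundle.extend (EuclideanSpace ℝ (Fin (n + 2))) u y)) (f p) :=
    g.mdifferentiableAt_inner (f := id) hZ hu
  rw [← mvfderiv_comp_apply p hZu hf v] at h2
  have h3 := h1.symm.trans h2
  rw [covAlong_field_comp_extend hf, FiberBundle.extend_apply_self] at h3
  exact add_right_cancel h3

/-- The Leibniz rule for a combination of two vector fields along a map. -/
theorem IsLeviCivita.covAlong_smul_add_smul (hD : IsLeviCivita g D) {f : M → Q} {p : M}
    {U V W : ∀ p : M, TangentSpace (𝓡 (n + 2)) (f p)} {a b : M → ℝ}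
    (hU : MDifferentiableAt (𝓡 m) (𝓡 (n + 2)).tangent
      (fun p ↦ (⟨f p, U p⟩ : TangentBundle (𝓡 (n + 2)) Q)) p)
    (hV : MDifferentiableAt (𝓡 m) (𝓡 (n + 2)).tangent
      (fun p ↦ (⟨f p, V p⟩ : TangentBundle (𝓡 (n + 2)) Q)) p)
    (hW : MDifferentiableAt (𝓡 m) (𝓡 (n + 2)).tangent
      (fun p ↦ (⟨f p, W p⟩ : TangentBundle (𝓡 (n + 2)) Q)) p)
    (ha : MDifferentiableAt (𝓡 m) 𝓘(ℝ, ℝ) a p) (hb : MDifferentiableAt (𝓡 m) 𝓘(ℝ, ℝ) b p)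
    (h : ∀ q, U q = a q • V q + b q • W q) (v : TangentSpace (𝓡 m) p) :
    covAlong D f U p v = (mvfderiv (𝓡 m) a p v • V p + a p • covAlong D f V p v) +
      (mvfderiv (𝓡 m) b p v • W p + b p • covAlong D f W p v) := by
  -- Pairing with a test field reduces the claim to the scalar Leibniz rule; the terms
  -- differentiating the test field match by the decomposition of `U p`.
  refine g.ext_inner fun u ↦ ?_
  have hf : MDifferentiableAt (𝓡 m) (𝓡 (n + 2)) f p := ((mdifferentiableAt_totalSpace ..).1 hU).1
  have hu := mdifferentiableAt_field_comp (mdifferentiableAt_extend_tangent u) hf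
  have h1 := hD.mvfderiv_inner_along hU hu v
  have h2 := hD.mvfderiv_inner_along hV hu v
  have h3 := hD.mvfderiv_inner_along hW hu v
  have hVu := g.mdifferentiableAt_inner hV hu
  have hWu := g.mdifferentiableAt_inner hW hu
  have h4 : (fun q ↦ g.inner (f q) (U q)
      (FiberBundle.extend (EuclideanSpace ℝ (Fin (n + 2))) u (f q))) =
      fun q ↦ a q * g.inner (f q) (V q)
        (FiberBundle.extend (EuclideanSpace ℝ (Fin (n + 2))) u (f q)) +
        b q * g.inner (f q) (W q)
          (FiberBundle.extend (EuclideanSpace ℝ (Fin (n + 2))) u (f q)) := by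
    ext q
    simp [h q]
  have haV : MDifferentiableAt (𝓡 m) 𝓘(ℝ, ℝ) (fun q ↦ a q * g.inner (f q) (V q)
      (FiberBundle.extend (EuclideanSpace ℝ (Fin (n + 2))) u (f q))) p := ha.mul hVu
  have hbW : MDifferentiableAt (𝓡 m) 𝓘(ℝ, ℝ) (fun q ↦ b q * g.inner (f q) (W q)
      (FiberBundle.extend (EuclideanSpace ℝ (Fin (n + 2))) u (f q))) p := hb.mul hWu
  rw [h4, mvfderiv_fun_add haV hbW, mvfderiv_fun_mul ha hVu,
    mvfderiv_fun_mul hb hWu] at h1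
  simp only [add_apply, smul_apply, smul_eq_mul, h2, h3, FiberBundle.extend_apply_self] at h1
  rw [h p] at h1
  simp only [map_add, map_smul, add_apply, smul_apply, smul_eq_mul] at h1 ⊢
  linarith

end

/-! ### Linear algebra of a normalized null pair -/

namespace NullLinear

variable {V T : Type*} [AddCommGroup V] [Module ℝ V] [AddCommGroup T] [Module ℝ T]
  {B : V →ₗ[ℝ] V →ₗ[ℝ] ℝ} {d : T →ₗ[ℝ] V} {S : Submodule ℝ T}

/-- Elements of the transversal line are orthogonal to the screen. -/
theorem transversal_orthogonal {y : V} (hy : y ∈ transversal B d S) {X : T} (hX : X ∈ S) :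
    B y (d X) = 0 := by
  have h : transversal B d S ≤ LinearMap.ker (B.flip (d X)) := by
    refine Submodule.span_le.2 ?_
    rintro N ⟨-, -, -, -, h⟩
    exact h X hX
  exact h hy

/-- A normalized null pair for a screen `S`. -/
structure IsPair (B : V →ₗ[ℝ] V →ₗ[ℝ] ℝ) (d : T →ₗ[ℝ] V) (S : Submodule ℝ T) (ξ : T) (N : V) :
    Prop where
  mem_radical : ξ ∈ radical B d
  pairing : B (d ξ) N = 1
  null : B N N = 0
  orthogonal : ∀ X ∈ S, B N (d X) = 0

theorem IsPair.mem_transversal {ξ : T} {N : V} (h : IsPair B d S ξ N) : N ∈ transversal B d S :=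
  Submodule.subset_span ⟨ξ, h.mem_radical, h.pairing, h.null, h.orthogonal⟩

theorem exists_isPair (hnt : transversal B d S ≠ ⊥) : ∃ ξ N, IsPair B d S ξ N := by
  by_contra! h
  refine hnt (Submodule.span_eq_bot.2 ?_)
  rintro N ⟨ξ, h1, h2, h3, h4⟩
  exact absurd ⟨h1, h2, h3, h4⟩ (h ξ N)

section

variable [FiniteDimensional ℝ V] [FiniteDimensional ℝ T] (hsymm : ∀ v w, B v w = B w v)
  (hnd : ∀ v, (∀ w, B v w = 0) → v = 0) (hd : Function.Injective d)
  (hdim : Module.finrank ℝ V = Module.finrank ℝ T + 1)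
  (hS : IsCompl S (radical B d)) {ξ : T} {N : V} (h : IsPair B d S ξ N)

include hd hdim h in
-- `N` is not tangent, because `d ξ` annihilates tangent vectors but pairs to `1` with `N`; a
-- hyperplane and a vector outside it span everything.
theorem IsPair.range_sup_span : LinearMap.range d ⊔ Submodule.span ℝ {N} = ⊤ := by
  have hNr : N ∉ LinearMap.range d := by
    rintro ⟨t, rfl⟩
    have h1 := h.pairing
    rw [h.mem_radical t] at h1
    exact zero_ne_one h1
  apply Submodule.eq_top_of_finrank_eq
  have h1 : Module.finrank ℝ (LinearMap.range d) = Module.finrank ℝ T :=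
    LinearMap.finrank_range_of_inj hd
  have h2 : LinearMap.range d < LinearMap.range d ⊔ Submodule.span ℝ {N} := by
    refine lt_of_le_of_ne le_sup_left fun h => hNr ?_
    rw [h]
    exact Submodule.mem_sup_right (Submodule.mem_span_singleton_self N)
  have h3 := Submodule.finrank_lt_finrank_of_lt h2
  have h4 := Submodule.finrank_le (LinearMap.range d ⊔ Submodule.span ℝ {N})
  omega

include hnd hd hdim h in
theorem IsPair.eq_zero {v : V} (h1 : ∀ t, B v (d t) = 0) (h2 : B v N = 0) : v = 0 := by
  refine hnd v fun w ↦ ?_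
  obtain ⟨_, ⟨t, rfl⟩, _, hc, rfl⟩ :=
    Submodule.mem_sup.1 (h.range_sup_span hd hdim ▸ Submodule.mem_top : w ∈ _)
  obtain ⟨c, rfl⟩ := Submodule.mem_span_singleton.1 hc
  simp [h1, h2]

include hnd hd hdim h in
/-- The radical is the line through `ξ`. -/
theorem IsPair.radical_eq_smul {r : T} (hr : r ∈ radical B d) : r = B (d r) N • ξ := by
  have hr' : ∀ w, B (d r) (d w) = 0 := hr
  have hξ' : ∀ w, B (d ξ) (d w) = 0 := h.mem_radical
  apply hd
  refine sub_eq_zero.1 (h.eq_zero hnd hd hdim (fun t ↦ ?_) ?_)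
  · simp [hr', hξ']
  · simp [h.pairing]

include hsymm hnd hd hdim hS h in
/-- A vector orthogonal to the screen is a combination of the null pair. -/
theorem IsPair.eq_smul_add_smul {z : V} (hz : ∀ X ∈ S, B z (d X) = 0) :
    z = B z N • d ξ + B z (d ξ) • N := by
  have hξ' : ∀ w, B (d ξ) (d w) = 0 := h.mem_radical
  have hN : B N (d ξ) = 1 := (hsymm _ _).trans h.pairing
  -- The difference is tested against the screen, the radical line through `ξ`, and `N`, which
  -- together span.
  refine sub_eq_zero.1 (h.eq_zero hnd hd hdim (fun t ↦ ?_) ?_)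
  · obtain ⟨s, hs, r, hr, rfl⟩ :=
      Submodule.mem_sup.1 (hS.sup_eq_top ▸ Submodule.mem_top : t ∈ S ⊔ radical B d)
    rw [h.radical_eq_smul hnd hd hdim hr]
    simp only [map_add, map_sub, map_smul, LinearMap.sub_apply, LinearMap.add_apply,
      LinearMap.smul_apply, smul_eq_mul, hξ', hN, hz s hs, h.orthogonal s hs]
    ring
  · simp [h.pairing, h.null]

include hsymm hnd hd hdim hS h in
-- Any generator `N'` is orthogonal to the screen, so `N' = a ξ + b N`. Its pairing with a radical
-- vector is `1`, which forces `b ≠ 0`, and nullity gives `2ab = 0`, so `a = 0`.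
theorem IsPair.transversal_eq_span : transversal B d S = Submodule.span ℝ {N} := by
  refine le_antisymm (Submodule.span_le.2 ?_)
    ((Submodule.span_singleton_le_iff_mem _ _).2 h.mem_transversal)
  rintro N' ⟨η, hη, h1, h2, h3⟩
  have hη' : ∀ w, B (d η) (d w) = 0 := hη
  have hξ' : ∀ w, B (d ξ) (d w) = 0 := h.mem_radical
  have hz := h.eq_smul_add_smul hsymm hnd hd hdim hS h3
  generalize B N' N = a at hz
  generalize B N' (d ξ) = b at hz
  have hN : B N (d ξ) = 1 := (hsymm _ _).trans h.pairing
  have hb : b ≠ 0 := by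
    rintro rfl
    rw [hz] at h1
    simp [hη'] at h1
  rw [hz] at h2
  simp only [map_add, map_smul, LinearMap.add_apply, LinearMap.smul_apply, smul_eq_mul, hξ', hN,
    h.pairing, h.null] at h2
  have ha : a = 0 := by
    have : a * b = 0 := by linarith
    exact (mul_eq_zero.1 this).resolve_right hb
  rw [hz, ha, zero_smul, zero_add]
  exact Submodule.smul_mem _ _ (Submodule.mem_span_singleton_self N)

include hnd hd hdim hS h in
/-- A tangent vector orthogonal to `N` lies in the screen. -/
theorem IsPair.mem_screen {t : T} (ht : B (d t) N = 0) (hsymm : ∀ v w, B v w = B w v) : t ∈ S := by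
  obtain ⟨s, hs, r, hr, rfl⟩ :=
    Submodule.mem_sup.1 (hS.sup_eq_top ▸ Submodule.mem_top : t ∈ S ⊔ radical B d)
  -- Pairing with `N` sees only the radical part, which is the multiple `B (d r) N` of `ξ`.
  have hsN : B (d s) N = 0 := (hsymm _ _).trans (h.orthogonal s hs)
  have hrN : B (d r) N = 0 := by simpa [hsN] using ht
  rw [h.radical_eq_smul hnd hd hdim hr, hrN, zero_smul, add_zero]
  exact hs

end

end NullLinear

/-! ### Geometry of the null hypersurface -/

section Null

variable {n : ℕ} {Q : Type*} [TopologicalSpace Q]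
  [ChartedSpace (EuclideanSpace ℝ (Fin (n + 2))) Q] [IsManifold (𝓡 (n + 2)) ∞ Q]
  {M : Type*} [TopologicalSpace M]
  [ChartedSpace (EuclideanSpace ℝ (Fin (n + 1))) M] [IsManifold (𝓡 (n + 1)) ∞ M]
  {g : LorentzianMetric n Q}

theorem ContMDiff.smul_along {m : ℕ} {M : Type*} [TopologicalSpace M]
    [ChartedSpace (EuclideanSpace ℝ (Fin m)) M] {f : M → Q} {a : M → ℝ}
    {V : ∀ p : M, TangentSpace (𝓡 (n + 2)) (f p)} (ha : ContMDiff (𝓡 m) 𝓘(ℝ, ℝ) ∞ a)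
    (hV : ContMDiff (𝓡 m) (𝓡 (n + 2)).tangent ∞
      (fun p ↦ (⟨f p, V p⟩ : TangentBundle (𝓡 (n + 2)) Q))) :
    ContMDiff (𝓡 m) (𝓡 (n + 2)).tangent ∞
      (fun p ↦ (⟨f p, a p • V p⟩ : TangentBundle (𝓡 (n + 2)) Q)) := by
  intro p
  obtain ⟨hf, hV'⟩ := contMDiffAt_totalSpace.1 (hV p)
  refine contMDiffAt_totalSpace.2 ⟨hf, ?_⟩
  refine ((ha p).smul hV').congr_of_eventuallyEq ?_
  set e := trivializationAt (EuclideanSpace ℝ (Fin (n + 2)))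
    (TangentSpace (𝓡 (n + 2)) (M := Q)) (f p)
  have hmem : f p ∈ e.baseSet := FiberBundle.mem_baseSet_trivializationAt' (f p)
  filter_upwards [hf.continuousAt.eventually (e.open_baseSet.mem_nhds hmem)] with q hq
  exact (e.linear ℝ hq).map_smul (a q) (V q)

theorem ContMDiff.sub_along {m : ℕ} {M : Type*} [TopologicalSpace M]
    [ChartedSpace (EuclideanSpace ℝ (Fin m)) M] {f : M → Q}
    {V W : ∀ p : M, TangentSpace (𝓡 (n + 2)) (f p)}
    (hV : ContMDiff (𝓡 m) (𝓡 (n + 2)).tangent ∞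
      (fun p ↦ (⟨f p, V p⟩ : TangentBundle (𝓡 (n + 2)) Q)))
    (hW : ContMDiff (𝓡 m) (𝓡 (n + 2)).tangent ∞
      (fun p ↦ (⟨f p, W p⟩ : TangentBundle (𝓡 (n + 2)) Q))) :
    ContMDiff (𝓡 m) (𝓡 (n + 2)).tangent ∞
      (fun p ↦ (⟨f p, V p - W p⟩ : TangentBundle (𝓡 (n + 2)) Q)) := by
  intro p
  obtain ⟨hf, hV'⟩ := contMDiffAt_totalSpace.1 (hV p)
  refine contMDiffAt_totalSpace.2 ⟨hf, ?_⟩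
  refine (hV'.sub (contMDiffAt_totalSpace.1 (hW p)).2).congr_of_eventuallyEq ?_
  set e := trivializationAt (EuclideanSpace ℝ (Fin (n + 2)))
    (TangentSpace (𝓡 (n + 2)) (M := Q)) (f p)
  have hmem : f p ∈ e.baseSet := FiberBundle.mem_baseSet_trivializationAt' (f p)
  filter_upwards [hf.continuousAt.eventually (e.open_baseSet.mem_nhds hmem)] with q hq
  exact (e.linear ℝ hq).map_sub (V q) (W q)

namespace NullHypersurface

variable (H : NullHypersurface g M)

theorem tan_d (p : M) (t : TangentSpace (𝓡 (n + 1)) p) : H.tan p (H.d p t) = t := by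
  rw [tan, LinearMap.comp_apply, LinearEquiv.coe_coe, LinearEquiv.symm_apply_eq]
  exact Submodule.projectionOnto_apply_left (H.isCompl_tr p)
    (LinearEquiv.ofInjective (H.d p) (H.immersion p) t)

theorem tan_of_mem_tr {p : M} {y : TangentSpace (𝓡 (n + 2)) (H.map p)} (hy : y ∈ H.tr p) :
    H.tan p y = 0 := by
  rw [tan, LinearMap.comp_apply, (Submodule.projectionOnto_apply_eq_zero_iff (H.isCompl_tr p)).2 hy,
    map_zero]

theorem exists_eq_d_tan_add (p : M) (z : TangentSpace (𝓡 (n + 2)) (H.map p)) :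
    ∃ y ∈ H.tr p, z = H.d p (H.tan p z) + y := by
  obtain ⟨_, ⟨t, rfl⟩, y, hy, rfl⟩ := Submodule.mem_sup.1
    ((H.isCompl_tr p).sup_eq_top ▸ Submodule.mem_top : z ∈ LinearMap.range (H.d p) ⊔ H.tr p)
  exact ⟨y, hy, by rw [map_add, tan_d, tan_of_mem_tr H hy, add_zero]⟩

theorem P_of_mem_rad {p : M} {r : TangentSpace (𝓡 (n + 1)) p} (hr : r ∈ g.rad H.map p) :
    H.P p r = 0 :=
  (Submodule.projection_apply_eq_zero_iff (H.isCompl p)).2 hr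

theorem P_of_mem_screen {p : M} {s : TangentSpace (𝓡 (n + 1)) p} (hs : s ∈ H.screen p) :
    H.P p s = s :=
  Submodule.projection_apply_left (H.isCompl p) ⟨s, hs⟩

theorem mem_rad_of_P {p : M} {r : TangentSpace (𝓡 (n + 1)) p} (hr : H.P p r = 0) :
    r ∈ g.rad H.map p :=
  (Submodule.projection_apply_eq_zero_iff (H.isCompl p)).1 hr

/-- The pairs at `p` that are normalized for the screen at `p`. -/
abbrev IsPairAt (p : M) (ξ : TangentSpace (𝓡 (n + 1)) p)
    (N : TangentSpace (𝓡 (n + 2)) (H.map p)) : Prop :=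
  NullLinear.IsPair (g.form (H.map p)) (H.d p) (H.screen p) ξ N

variable {H}

theorem IsNullPair.isPairAt {ξ : ∀ p : M, TangentSpace (𝓡 (n + 1)) p}
    {N : ∀ p : M, TangentSpace (𝓡 (n + 2)) (H.map p)} (h : H.IsNullPair ξ N) (p : M) :
    H.IsPairAt p (ξ p) (N p) :=
  ⟨h.mem_rad p, h.pairing p, h.null p, h.orthogonal p⟩

instance finiteDimensional_tangentSpace (k : ℕ) {X : Type*} [TopologicalSpace X]
    [ChartedSpace (EuclideanSpace ℝ (Fin k)) X] (p : X) :
    FiniteDimensional ℝ (TangentSpace (𝓡 k) p) :=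
  inferInstanceAs (FiniteDimensional ℝ (EuclideanSpace ℝ (Fin k)))

theorem finrank_tangentSpace (k : ℕ) {X : Type*} [TopologicalSpace X]
    [ChartedSpace (EuclideanSpace ℝ (Fin k)) X] (p : X) :
    Module.finrank ℝ (TangentSpace (𝓡 k) p) = k :=
  finrank_euclideanSpace_fin (𝕜 := ℝ) (n := k)

variable {p : M} {ξ : TangentSpace (𝓡 (n + 1)) p} {N : TangentSpace (𝓡 (n + 2)) (H.map p)}

theorem finrank_ambient (p : M) : Module.finrank ℝ (TangentSpace (𝓡 (n + 2)) (H.map p)) =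
    Module.finrank ℝ (TangentSpace (𝓡 (n + 1)) p) + 1 := by
  rw [finrank_tangentSpace, finrank_tangentSpace]

/-- With no screen component the tangential part of `z` is radical, and the transversal part is
orthogonal to the screen; hence so is `z`, and the linear decomposition applies. -/
theorem IsPairAt.eq_smul_add_smul (h : H.IsPairAt p ξ N) {z : TangentSpace (𝓡 (n + 2)) (H.map p)}
    (hz : H.P p (H.tan p z) = 0) :
    z = g.inner (H.map p) z N • H.d p ξ + g.inner (H.map p) z (H.d p ξ) • N := by
  refine NullLinear.IsPair.eq_smul_add_smul (g.symm _) (g.nondegenerate _) (H.immersion p)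
    (finrank_ambient (H := H) p) (H.isCompl p) h fun X hX ↦ ?_
  obtain ⟨y, hy, hzy⟩ := H.exists_eq_d_tan_add p z
  have h1 : g.form (H.map p) (H.d p (H.tan p z)) (H.d p X) = 0 := H.mem_rad_of_P hz X
  change g.form (H.map p) z (H.d p X) = 0
  rw [hzy, map_add, LinearMap.add_apply, h1, NullLinear.transversal_orthogonal hy hX, add_zero]

theorem IsPairAt.rad_eq_smul (h : H.IsPairAt p ξ N) {r : TangentSpace (𝓡 (n + 1)) p}
    (hr : r ∈ g.rad H.map p) : r = g.inner (H.map p) (H.d p r) N • ξ :=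
  NullLinear.IsPair.radical_eq_smul (g.nondegenerate _) (H.immersion p)
    (finrank_ambient (H := H) p) h hr

/-- The tangential part of a vector orthogonal to `N` lies in the screen. -/
theorem IsPairAt.tan_mem_screen (h : H.IsPairAt p ξ N) {z : TangentSpace (𝓡 (n + 2)) (H.map p)}
    (hz : g.inner (H.map p) z N = 0) : H.tan p z ∈ H.screen p := by
  refine NullLinear.IsPair.mem_screen (g.nondegenerate _) (H.immersion p)
    (finrank_ambient (H := H) p) (H.isCompl p) h ?_ (g.symm _)
  obtain ⟨y, hy, hzy⟩ := H.exists_eq_d_tan_add p z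
  -- The transversal part is a multiple of the null vector `N`, so the tangential part of `z` is
  -- also orthogonal to `N`.
  rw [tr, NullLinear.IsPair.transversal_eq_span (d := H.d p) (g.symm _) (g.nondegenerate _)
    (H.immersion p) (finrank_ambient (H := H) p) (H.isCompl p) h] at hy
  obtain ⟨c, rfl⟩ := Submodule.mem_span_singleton.1 hy
  have h1 : g.inner (H.map p) N N = 0 := h.null
  rw [hzy] at hz
  simpa [h1] using! hz

/-- If the pairing vanished, the decomposition would leave only a multiple of `ξ`, making `z`
tangent. -/
theorem IsPairAt.inner_ne_zero (h : H.IsPairAt p ξ N) {z : TangentSpace (𝓡 (n + 2)) (H.map p)}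
    (hz : H.P p (H.tan p z) = 0) (hzr : z ∉ LinearMap.range (H.d p)) :
    g.inner (H.map p) z (H.d p ξ) ≠ 0 := by
  intro h0
  have h1 := h.eq_smul_add_smul hz
  rw [h0, zero_smul, add_zero] at h1
  exact hzr ⟨g.inner (H.map p) z N • ξ, by rw [map_smul, ← h1]⟩

theorem exists_isPairAt {z : TangentSpace (𝓡 (n + 2)) (H.map p)}
    (hzr : z ∉ LinearMap.range (H.d p)) : ∃ ξ N, H.IsPairAt p ξ N := by
  refine NullLinear.exists_isPair fun h ↦ hzr ?_
  have h1 := (H.isCompl_tr p).sup_eq_top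
  rw [tr, h, sup_bot_eq] at h1
  rw [h1]
  trivial

/-- The given radical section has no companion `N` yet. A pointwise pair exists by
`exists_isPairAt`, and its `ξ` spans the radical, so `r` is a nonzero multiple of it. -/
theorem inner_rad_ne_zero {z : TangentSpace (𝓡 (n + 2)) (H.map p)}
    (hz : H.P p (H.tan p z) = 0) (hzr : z ∉ LinearMap.range (H.d p))
    {r : TangentSpace (𝓡 (n + 1)) p} (hr : r ∈ g.rad H.map p) (hr0 : r ≠ 0) :
    g.inner (H.map p) z (H.d p r) ≠ 0 := by
  obtain ⟨ξ, N, h⟩ := exists_isPairAt hzr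
  have h1 := h.rad_eq_smul hr
  rw [h1, map_smul, map_smul]
  refine mul_ne_zero (fun h0 ↦ hr0 ?_) (h.inner_ne_zero hz hzr)
  rw [h1, h0, zero_smul]

theorem smooth_d (H : NullHypersurface g M) {ξ : ∀ p : M, TangentSpace (𝓡 (n + 1)) p}
    (hξ : IsSmoothField ξ) :
    ContMDiff (𝓡 (n + 1)) (𝓡 (n + 2)).tangent ∞
      (fun p ↦ (⟨H.map p, H.d p (ξ p)⟩ : TangentBundle (𝓡 (n + 2)) Q)) :=
  (H.smooth.contMDiff_tangentMap (m := ∞) (by simp)).comp hξ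

/-- A nowhere tangent vector field without screen component yields a normalized pair. -/
theorem exists_isNullPair (H : NullHypersurface g M) {Z : ∀ x : Q, TangentSpace (𝓡 (n + 2)) x}
    (hZ : IsSmoothField Z) (hscreen : ∀ p : M, H.screenComponent Z p = 0)
    (htransverse : ∀ p : M, Z (H.map p) ∉ LinearMap.range (H.d p)) :
    ∃ ξ N, H.IsNullPair ξ N := by
  obtain ⟨ξ, hξ, hξr⟩ := H.degenerate
  have hb (p : M) : g.inner (H.map p) (Z (H.map p)) (H.d p (ξ p)) ≠ 0 :=
    inner_rad_ne_zero (hscreen p) (htransverse p) (hξr p).2 (hξr p).1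
  have hZs : ContMDiff (𝓡 (n + 1)) (𝓡 (n + 2)).tangent ∞
      (fun p ↦ (⟨H.map p, Z (H.map p)⟩ : TangentBundle (𝓡 (n + 2)) Q)) := hZ.comp H.smooth
  have hξs := H.smooth_d hξ
  have hbs := g.contMDiff_inner hZs hξs
  -- From `Z = a ξ + b N` one gets `g(Z, Z) = 2ab`, so `a = g(Z, Z) / (2b)` and `N = b⁻¹ (Z - a ξ)`;
  -- this expression is smooth because `b` has no zero.
  refine ⟨ξ, fun p ↦ (g.inner (H.map p) (Z (H.map p)) (H.d p (ξ p)))⁻¹ • (Z (H.map p) -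
    (g.inner (H.map p) (Z (H.map p)) (Z (H.map p)) /
      (2 * g.inner (H.map p) (Z (H.map p)) (H.d p (ξ p)))) • H.d p (ξ p)), hξ, fun p ↦ (hξr p).2,
    ?_, fun p ↦ ?_, fun p ↦ ?_, fun p X hX ↦ ?_⟩
  · refine (hbs.inv₀ hb).smul_along (hZs.sub_along (ContMDiff.smul_along ?_ hξs))
    exact (g.contMDiff_inner hZs hZs).div₀ (contMDiff_const.mul hbs)
      fun p ↦ mul_ne_zero two_ne_zero (hb p)
  all_goals
    have h0 : ∀ w, g.inner (H.map p) (H.d p (ξ p)) (H.d p w) = 0 := (hξr p).2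
    have h1 := hb p
    have h2 := g.symm (H.map p) (H.d p (ξ p)) (Z (H.map p))
  · simp [h0, h2, h1]
  · simp only [map_smul, map_sub, smul_apply, sub_apply, smul_eq_mul, h0, h2]
    field_simp
    ring
  · obtain ⟨y, hy, hzy⟩ := H.exists_eq_d_tan_add p (Z (H.map p))
    have h3 : g.inner (H.map p) (H.d p (H.tan p (Z (H.map p)))) (H.d p X) = 0 :=
      H.mem_rad_of_P (hscreen p) X
    have h4 : g.inner (H.map p) y (H.d p X) = 0 := NullLinear.transversal_orthogonal hy hX
    have h5 : g.inner (H.map p) (Z (H.map p)) (H.d p X) = 0 := by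
      rw [hzy, map_add, add_apply, h3, h4, add_zero]
    simp [h5, h0]

/-- The shape operator of the transversal section of a normalized pair is screen valued. -/
theorem IsNullPair.shape_mem_screen {D : CovariantDerivative (𝓡 (n + 2))
      (EuclideanSpace ℝ (Fin (n + 2))) (fun x : Q ↦ TangentSpace (𝓡 (n + 2)) x)}
    (hD : IsLeviCivita g D) {ξ : ∀ p : M, TangentSpace (𝓡 (n + 1)) p}
    {N : ∀ p : M, TangentSpace (𝓡 (n + 2)) (H.map p)} (h : H.IsNullPair ξ N) (p : M)
    (v : TangentSpace (𝓡 (n + 1)) p) : H.shape D N p v ∈ H.screen p := by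
  have hN := h.smooth_N.mdifferentiableAt (x := p) (by simp)
  -- Differentiating `g(N, N) = 0` gives `2 g(D_v N, N) = 0`.
  have h1 := hD.mvfderiv_inner_along hN hN v
  have h2 : (fun q ↦ g.inner (H.map q) (N q) (N q)) = fun _ ↦ 0 := funext h.null
  rw [h2, mvfderiv_const, g.symm _ (N p), zero_apply] at h1
  have h3 : g.inner (H.map p) (covAlong D H.map N p v) (N p) = 0 := by linarith
  exact Submodule.neg_mem _ ((h.isPairAt p).tan_mem_screen h3)

theorem IsNullPair.isQuasiConformalPair {D : CovariantDerivative (𝓡 (n + 2))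
      (EuclideanSpace ℝ (Fin (n + 2))) (fun x : Q ↦ TangentSpace (𝓡 (n + 2)) x)}
    (hD : IsLeviCivita g D) {Z : ∀ x : Q, TangentSpace (𝓡 (n + 2)) x} {φ : Q → ℝ}
    (hZ : IsClosedConformal D Z φ) (hscreen : ∀ p : M, H.screenComponent Z p = 0)
    (htransverse : ∀ p : M, Z (H.map p) ∉ LinearMap.range (H.d p))
    {ξ : ∀ p : M, TangentSpace (𝓡 (n + 1)) p} {N : ∀ p : M, TangentSpace (𝓡 (n + 2)) (H.map p)}
    (h : H.IsNullPair ξ N) :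
    H.IsQuasiConformalPair D ξ N
      (fun p ↦ -(g.inner (H.map p) (Z (H.map p)) (N p) /
        g.inner (H.map p) (Z (H.map p)) (H.d p (ξ p))))
      (fun p ↦ -(φ (H.map p) / g.inner (H.map p) (Z (H.map p)) (H.d p (ξ p)))) := by
  have hZs : ContMDiff (𝓡 (n + 1)) (𝓡 (n + 2)).tangent ∞
      (fun p ↦ (⟨H.map p, Z (H.map p)⟩ : TangentBundle (𝓡 (n + 2)) Q)) :=
    hZ.smooth_field.comp H.smooth
  have hξs := H.smooth_d h.smooth_xi
  have has := g.contMDiff_inner hZs h.smooth_N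
  have hbs := g.contMDiff_inner hZs hξs
  have hb (p : M) := (h.isPairAt p).inner_ne_zero (hscreen p) (htransverse p)
  refine ⟨(has.div₀ hbs hb).neg, ((hZ.smooth_function.comp H.smooth).div₀ hbs hb).neg,
    fun p ↦ LinearMap.ext fun v ↦ ?_⟩
  -- Leibniz rule for `Z = a ξ + b N`; the chain rule and closed conformality then make the left
  -- side `φ` times the image of `v`.
  have h1 := hD.covAlong_smul_add_smul (hZs.mdifferentiableAt (x := p) (by simp))
    (hξs.mdifferentiableAt (by simp)) (h.smooth_N.mdifferentiableAt (by simp))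
    (has.mdifferentiableAt (by simp)) (hbs.mdifferentiableAt (by simp))
    (fun q ↦ (h.isPairAt q).eq_smul_add_smul (hscreen q)) v
  rw [hD.covAlong_field_comp (hZ.smooth_field.mdifferentiableAt (by simp))
    (H.smooth.mdifferentiableAt (by simp)), hZ.eq] at h1
  -- Taking screen components removes the derivatives of `a` and `b`, since `ξ` is radical and `N`
  -- transversal; `P` fixes `A_N v` because it already lies in the screen.
  have h2 := congrArg (fun z ↦ H.P p (H.tan p z)) h1
  have hdv : mfderiv (𝓡 (n + 1)) (𝓡 (n + 2)) H.map p v = H.d p v := rfl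
  have hsc : H.P p (H.tan p (covAlong D H.map (fun q ↦ H.d q (ξ q)) p v)) =
      -H.screenShape D ξ p v := by
    simp [screenShape, induced]
  have hsh : H.tan p (covAlong D H.map N p v) = -H.shape D N p v := by
    simp [shape]
  simp only [hdv, map_add, map_smul, tan_d, H.tan_of_mem_tr (h.isPairAt p).mem_transversal,
    H.P_of_mem_rad (h.mem_rad p), hsc, hsh, map_neg,
    H.P_of_mem_screen (h.shape_mem_screen hD p v), smul_zero, zero_add, smul_neg] at h2
  have hbp := hb p
  simp only [LinearMap.add_apply, LinearMap.smul_apply]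
  generalize g.inner (H.map p) (Z (H.map p)) (H.d p (ξ p)) = b at *
  generalize g.inner (H.map p) (Z (H.map p)) (N p) = a at *
  have h3 : b • H.shape D N p v = -(a • H.screenShape D ξ p v) - φ (H.map p) • H.P p v := by
    rw [h2]
    abel
  -- `h3` is `b A_N v = -a A*_ξ v - φ P v`; it remains to divide by `b`.
  rw [← inv_smul_smul₀ hbp (H.shape D N p v), h3]
  module

end NullHypersurface

end Null

theorem mainTheorem8 {n : ℕ}
    {Q : Type*} [TopologicalSpace Q] [ChartedSpace (EuclideanSpace ℝ (Fin (n + 2))) Q]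
    [IsManifold (𝓡 (n + 2)) ∞ Q]
    {M : Type*} [TopologicalSpace M] [ChartedSpace (EuclideanSpace ℝ (Fin (n + 1))) M]
    [IsManifold (𝓡 (n + 1)) ∞ M]
    (g : LorentzianMetric n Q)
    (D : CovariantDerivative (𝓡 (n + 2)) (EuclideanSpace ℝ (Fin (n + 2)))
      (fun x : Q ↦ TangentSpace (𝓡 (n + 2)) x))
    (hD : IsLeviCivita g D)
    (H : NullHypersurface g M)
    (Z : ∀ x : Q, TangentSpace (𝓡 (n + 2)) x) (φ : Q → ℝ)
    (hZ : IsClosedConformal D Z φ)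
    (hscreen : ∀ p : M, H.screenComponent Z p = 0)
    (htransverse : ∀ p : M, Z (H.map p) ∉ LinearMap.range (H.d p)) :
    H.IsScreenQuasiConformal D ∧
    ∀ (ξ : ∀ p : M, TangentSpace (𝓡 (n + 1)) p)
      (N : ∀ p : M, TangentSpace (𝓡 (n + 2)) (H.map p)), H.IsNullPair ξ N →
      (∀ p : M, g.inner (H.map p) (Z (H.map p)) (H.d p (ξ p)) ≠ 0) ∧
      H.IsQuasiConformalPair D ξ N
        (fun p ↦ -(g.inner (H.map p) (Z (H.map p)) (N p) /
          g.inner (H.map p) (Z (H.map p)) (H.d p (ξ p))))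
        (fun p ↦ -(φ (H.map p) / g.inner (H.map p) (Z (H.map p)) (H.d p (ξ p)))) := by
  refine ⟨?_, fun ξ N h ↦ ⟨fun p ↦ (h.isPairAt p).inner_ne_zero (hscreen p) (htransverse p),
    h.isQuasiConformalPair hD hZ hscreen htransverse⟩⟩
  obtain ⟨ξ, N, h⟩ := H.exists_isNullPair hZ.smooth_field hscreen htransverse
  exact ⟨ξ, N, h, _, _, h.isQuasiConformalPair hD hZ hscreen htransverse⟩
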